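/- Let $k$ be a field, let $q^{1/4}\in k$ be nonzero (and write $q^{n/4}$ for its powers), and let $c_1,c_2,d_1,d_2\in k$. **Diagrams.** A *triframed planar diagram* is an oriented planar diagram with transversal over/under crossings of one arc, running from its *leg* to its *head*, with vertically downward tangents at both ends, possibly together with oriented closed curves; without closed curves it is a triframed planar knotoid diagram. Diagrams are taken in Morse position, i.e. as vertical stacks of layers, each consisting of vertical strands and one elementary piece (a leg, a head, a local maximum, a local minimum, or a crossing). Two diagrams are *equivalent* if they are related by planar isotopies that fix the end-points and their tangents, and by the moves $R1'$ (a curl changes sides and keeps its sign), $R2$ and $R3$ away from the end-points; planar isotopy of diagrams in Morse position is generated by exchanging the heights of pieces next to each other (but not of the two end-points), cancelling a maximum against an adjacent minimum, and sliding a strand that crosses one branch of an extremum to the other branch. Strands may not be moved across end-points. **The assignment.** Let $V=k^2$ have basis $e_1,e_2$ and let $V^*$ have the dual basis $e^1,e^2$. Read diagrams from top to bottom, with downward strands standing for $V$ and upward strands for $V^*$. The Reshetikhin–Turaev assignment $\varphi$ of $U_q(\mathfrak{sl}_2)$ and its standard representation $V$ sends horizontal juxtaposition to $\otimes$ and vertical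 stacking to composition, and its values on pieces are as follows. The positive crossing of two downward strands goes to $$R=\begin{pmatrix} q^{1/4}&0&0&0\\0&0&q^{-1/4}&0\\0&q^{-1/4}&q^{1/4}-q^{-3/4}&0\\0&0&0&q^{1/4}\end{pmatrix}$$ in the basis $e_1\otimes e_1,e_1\otimes e_2,e_2\otimes e_1,e_2\otimes e_2$, and the negative one to $R^{-1}$. Maxima go to $1\mapsto \sum_i e_i\otimes e^i$ and $1\mapsto q^{-1/2}e^1\otimes e_1+q^{1/2}e^2\otimes e_2$. Minima go to $e^i\otimes e_j\mapsto\delta_{ij}$ and to $e_i\otimes e^j\mapsto \delta_{ij}\mu_i$ with $\mu_1=q^{1/2}$, $\mu_2=q^{-1/2}$. Crossings with upward strands are obtained from these by rotation. Extend $\varphi$ to the leg and the head by the linear maps $\eta:k\to V$, $1\mapsto c_1e_1+c_2e_2$, and $\epsilon:V\to k$, $e_i\mapsto d_i$. A diagram $D$ is thereby sent to a linear map $k\to k$, i.e. to a scalar $Q_{\mathfrak{sl}_2}(D)\in k$. **Proposition 3.10.** For every choice of the parameters $c_1,c_2,d_1,d_2$: 1. Equivalent triframed planar diagrams have the same value $Q_{\mathfrak{sl}_2}$.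 In particular this is a four-parameter family of invariants of triframed planar knotoid diagrams. 2. The values of $\varphi$ on maxima, minima and all crossings are morphisms of $U_q(\mathfrak{sl}_2)$-modules (that is, they commute with the actions of $E,F,K^{\pm1}$), and the values on the leg and the head are $1\mapsto c_1e_1+c_2e_2$ and $e_i\mapsto d_i$. 3. $R$ is invertible and $q^{1/4}R-q^{-1/4}R^{-1}=(q^{1/2}-q^{-1/2})I_4$. Hence the skein relation: if $D_+,D_-,D_0$ agree except at one place, where they have a positive crossing, a negative crossing and the oriented smoothing respectively, then $$q^{1/4}Q_{\mathfrak{sl}_2}(D_+)-q^{-1/4}Q_{\mathfrak{sl}_2}(D_-)=(q^{1/2}-q^{-1/2})\,Q_{\mathfrak{sl}_2}(D_0).$$ 4. Adding a small circle without crossings multiplies $Q_{\mathfrak{sl}_2}$ by $q^{1/2}+q^{-1/2}$, adding a positive (negative) curl multiplies it by $q^{3/4}$ (by $q^{-3/4}$), and the value of a vertical segment is $c_1d_1+c_2d_2$. -/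

import Mathlib

namespace TriKnotoid

/-! ## Triframed planar knotoid diagrams in Morse position

Diagrams are read from top to bottom and left to right.  A diagram in Morse position is a vertical
stack of layers; every layer consists of vertical strands and exactly one elementary piece. -/

/-- The direction in which a strand crosses a horizontal level. -/
inductive Dir
  | down
  | up
  deriving DecidableEq

/-- The opposite direction. -/
def Dir.flip : Dir → Dir
  | .down => .up
  | .up => .down

/-- Which strand of a crossing lies on top: with `slash` it is the one joining the top right to the
bottom left, with `back` the one joining the top left to the bottom right. -/
inductive Over
  | slash
  | back
  deriving DecidableEq

/-- Crossing change. -/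
def Over.flip : Over → Over
  | .slash => .back
  | .back => .slash

/-- Elementary pieces.
* `leg`: the initial point of the arc, with tangent pointing vertically downwards;
* `head`: the final point of the arc, with tangent pointing vertically downwards;
* `coev a`: a local maximum whose left branch has direction `a`;
* `ev a`: a local minimum whose left branch has direction `a`;
* `cross o a b`: a crossing, whose top left strand has direction `a` and whose top right strand has
  direction `b`. -/
inductive Elem
  | leg
  | head
  | coev (a : Dir)
  | ev (a : Dir)
  | cross (o : Over) (a b : Dir)
  deriving DecidableEq

/-- The directions of the strands that enter the piece at its top. -/
def Elem.src : Elem → List Dir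
  | .leg => []
  | .head => [.down]
  | .coev _ => []
  | .ev a => [a, a.flip]
  | .cross _ a b => [a, b]

/-- The directions of the strands that leave the piece at its bottom. -/
def Elem.tgt : Elem → List Dir
  | .leg => [.down]
  | .head => []
  | .coev a => [a, a.flip]
  | .ev _ => []
  | .cross _ a b => [b, a]

/-- The piece is one of the two end-points of the arc. -/
def Elem.IsEndpoint (g : Elem) : Prop := g = .leg ∨ g = .head

/-- The horizontal juxtaposition of vertical strands `left`, a piece `piece`, and vertical
strands `right`. -/
structure Layer where
  left : List Dir
  piece : Elem
  right : List Dir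
  deriving DecidableEq

/-- The strands at the top of a layer. -/
def Layer.src (L : Layer) : List Dir := L.left ++ L.piece.src ++ L.right

/-- The strands at the bottom of a layer. -/
def Layer.tgt (L : Layer) : List Dir := L.left ++ L.piece.tgt ++ L.right

/-- `IsTangle w T w'`: the layers `T`, stacked from top to bottom, fit together to an oriented
tangle diagram with strands `w` at the top and `w'` at the bottom. -/
def IsTangle : List Dir → List Layer → List Dir → Prop
  | w, [], w' => w = w'
  | w, L :: T, w' => w = L.src ∧ IsTangle L.tgt T w'

/-- A planar diagram in Morse position of one oriented arc, running from its leg to its head, with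
vertically downward tangents at both ends, possibly together with oriented closed curves.  Those
without closed curves are the knotoid diagrams; closed curves are needed because smoothing a
crossing of a knotoid diagram may create one. -/
structure Diagram where
  layers : List Layer
  isTangle : IsTangle [] layers []
  one_leg : (layers.map Layer.piece).count .leg = 1
  one_head : (layers.map Layer.piece).count .head = 1

/-- An `o`-crossing curl on the right-hand side of a strand of direction `a`. -/
def curlRight (o : Over) (a : Dir) (l r : List Dir) : List Layer :=
  [⟨l ++ [a], .coev a, r⟩, ⟨l, .cross o a a, [a.flip] ++ r⟩, ⟨l ++ [a], .ev a, r⟩]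

/-- An `o`-crossing curl on the left-hand side of a strand of direction `a`. -/
def curlLeft (o : Over) (a : Dir) (l r : List Dir) : List Layer :=
  [⟨l, .coev a.flip, [a] ++ r⟩, ⟨l ++ [a.flip], .cross o a a, r⟩, ⟨l, .ev a.flip, [a] ++ r⟩]

/-- The local moves.  The words `l` and `r` are the strands to the left and to the right. -/
inductive Move : List Layer → List Layer → Prop
  /-- Planar isotopy: two pieces next to each other exchange their heights.  The two end-points are
  fixed points of the plane, at different heights, and do not move past each other. -/
  | exchange (l m r : List Dir) (g h : Elem) (hgh : ¬ (g.IsEndpoint ∧ h.IsEndpoint)) :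
      Move [⟨l, g, m ++ h.src ++ r⟩, ⟨l ++ g.tgt ++ m, h, r⟩]
        [⟨l ++ g.src ++ m, h, r⟩, ⟨l, g, m ++ h.tgt ++ r⟩]
  /-- Planar isotopy: a maximum cancels against an adjacent minimum. -/
  | zigzagRight (l r : List Dir) (a : Dir) :
      Move [⟨l ++ [a], .coev a.flip, r⟩, ⟨l, .ev a, [a] ++ r⟩] []
  | zigzagLeft (l r : List Dir) (a : Dir) :
      Move [⟨l, .coev a, [a] ++ r⟩, ⟨l ++ [a], .ev a.flip, r⟩] []
  /-- Planar isotopy: a strand crossing one branch of a minimum is moved to the other branch. -/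
  | slideMin (l r : List Dir) (o : Over) (a b : Dir) :
      Move [⟨l, .cross o b a, [b.flip] ++ r⟩, ⟨l ++ [a], .ev b, r⟩]
        [⟨l ++ [b], .cross o.flip a b.flip, r⟩, ⟨l, .ev b, [a] ++ r⟩]
  /-- Planar isotopy: a strand crossing one branch of a maximum is moved to the other branch. -/
  | slideMax (l r : List Dir) (o : Over) (a b : Dir) :
      Move [⟨l ++ [a], .coev b, r⟩, ⟨l, .cross o a b, [b.flip] ++ r⟩]
        [⟨l, .coev b, [a] ++ r⟩, ⟨l ++ [b], .cross o.flip b.flip a, r⟩]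
  /-- The weakened first Reidemeister move: a curl changes sides and keeps its sign. -/
  | R1' (l r : List Dir) (o : Over) (a : Dir) :
      Move (curlRight o a l r) (curlLeft o a l r)
  /-- The second Reidemeister move. -/
  | R2 (l r : List Dir) (o : Over) (a b : Dir) :
      Move [⟨l, .cross o a b, r⟩, ⟨l, .cross o.flip b a, r⟩] []
  /-- The third Reidemeister move.  The versions with mixed crossings follow from these by `R2`. -/
  | R3 (l r : List Dir) (o : Over) (a b c : Dir) :
      Move [⟨l, .cross o a b, [c] ++ r⟩, ⟨l ++ [b], .cross o a c, r⟩, ⟨l, .cross o b c, [a] ++ r⟩]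
        [⟨l ++ [a], .cross o b c, r⟩, ⟨l, .cross o a c, [b] ++ r⟩, ⟨l ++ [c], .cross o a b, r⟩]

/-- `D'` arises from `D` by replacing one side of a local move by the other. -/
def Step (D D' : Diagram) : Prop :=
  ∃ top bot A B, Move A B ∧ D.layers = top ++ A ++ bot ∧ D'.layers = top ++ B ++ bot

/-- Equivalence of triframed planar diagrams: planar isotopies fixing the end-points and their
tangents, and the moves `R1'`, `R2`, `R3` away from the end-points.  Strands are not moved across
end-points. -/
def TriframedEquiv : Diagram → Diagram → Prop := Relation.EqvGen Step

/-! ## The assignment `φ` for `U_q(sl_2)` and its standard representation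

Everywhere `s` stands for `q^{1/4}`, so `s ^ 2 = q^{1/2}`, and so on.  The standard basis `e_1, e_2`
of `V = k²` and the dual basis `e^1, e^2` of `V*` are indexed by `Fin 2`.  A tensor product of
copies of `V` (downward strands) and `V*` (upward strands) has as its basis the words in these
letters. -/

section Assignment

variable {k : Type*} [Field k]

/-- The matrix of the braiding `R = Ψ : V ⊗ V → V ⊗ V` with respect to the ordered basis
`e_1 ⊗ e_1, e_1 ⊗ e_2, e_2 ⊗ e_1, e_2 ⊗ e_2` (columns are images of basis vectors). -/
def R (s : k) : Matrix (Fin 4) (Fin 4) k :=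
  !![s, 0, 0, 0;
     0, 0, s⁻¹, 0;
     0, s⁻¹, s - (s ^ 3)⁻¹, 0;
     0, 0, 0, s]

/-- The position of `e_i ⊗ e_j` in the ordered basis of `V ⊗ V`. -/
def pos (i j : Fin 2) : Fin 4 := finProdFinEquiv (i, j)

/-- `R` for crossings of type `slash`, `R⁻¹` for those of type `back`. -/
noncomputable def Rpow (s : k) : Over → Matrix (Fin 4) (Fin 4) k
  | .slash => R s
  | .back => (R s)⁻¹

/-- Maxima: `coev down` is the coevaluation `1 ↦ ∑ i, e_i ⊗ e^i`, and `coev up` is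
`1 ↦ q^{-1/2} e^1 ⊗ e_1 + q^{1/2} e^2 ⊗ e_2`.  The value is the coefficient of the `i`-th term. -/
def coevCoeff (s : k) : Dir → Fin 2 → k
  | .down => ![1, 1]
  | .up => ![(s ^ 2)⁻¹, s ^ 2]

/-- Minima: `ev up` is the evaluation `e^i ⊗ e_j ↦ δ_ij`, and `ev down` is
`e_i ⊗ e^j ↦ δ_ij q^{1/2}, δ_ij q^{-1/2}` for `i = 1, 2`.  The value is the coefficient
for `i = j`. -/
def evCoeff (s : k) : Dir → Fin 2 → k
  | .up => ![1, 1]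
  | .down => ![s ^ 2, (s ^ 2)⁻¹]

/-- `crossCoeff s o a b i j m n` is the coefficient of the basis vector `m ⊗ n` in the image of
the basis vector `i ⊗ j` under the crossing `cross o a b`.  Crossings with upward strands carry the
braiding with `V*`, which in a rigid braided category is obtained from `R` and `R⁻¹` by rotating
the crossing:
* for `V* ⊗ V` it is `(ev ⊗ id ⊗ id) ∘ (id ⊗ R^∓ ⊗ id) ∘ (id ⊗ id ⊗ coev)`;
* for `V ⊗ V*` it is the mirror image of this, with the maxima and minima of the other
  orientation;
* for `V* ⊗ V*` it is the rotation by a half turn, which is a transposition. -/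
noncomputable def crossCoeff (s : k) (o : Over) : Dir → Dir → Fin 2 → Fin 2 → Fin 2 → Fin 2 → k
  | .down, .down, i, j, m, n => Rpow s o (pos m n) (pos i j)
  | .up, .down, i, j, m, n => Rpow s o.flip (pos i m) (pos j n)
  | .down, .up, i, j, m, n =>
      coevCoeff s .up m * evCoeff s .down j * Rpow s o.flip (pos n j) (pos m i)
  | .up, .up, i, j, m, n => Rpow s o (pos j i) (pos n m)

/-- The linear map assigned to an elementary piece, on basis vectors.  The leg is the map
`η : k → V`, `1 ↦ ∑ i, c_i e_i`, and the head is the map `ε : V → k`, `e_i ↦ d_i`. -/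
noncomputable def pieceMap (s : k) (c d : Fin 2 → k) : Elem → List (Fin 2) → (List (Fin 2) →₀ k)
  | .leg, [] => ∑ i, Finsupp.single [i] (c i)
  | .head, [i] => Finsupp.single [] (d i)
  | .coev a, [] => ∑ i, Finsupp.single [i, i] (coevCoeff s a i)
  | .ev a, [i, j] => if i = j then Finsupp.single [] (evCoeff s a i) else 0
  | .cross o a b, [i, j] => ∑ m, ∑ n, Finsupp.single [m, n] (crossCoeff s o a b i j m n)
  | _, _ => 0

/-- The linear map `id ⊗ (map of the piece) ⊗ id` assigned to a layer. -/
noncomputable def layerMap (s : k) (c d : Fin 2 → k) (L : Layer) :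
    (List (Fin 2) →₀ k) →ₗ[k] (List (Fin 2) →₀ k) :=
  Finsupp.linearCombination k fun x =>
    (pieceMap s c d L.piece
      ((x.drop L.left.length).take L.piece.src.length)).mapDomain fun y =>
        x.take L.left.length ++ y ++ x.drop (L.left.length + L.piece.src.length)

/-- The assignment `φ`: vertical stacking of layers goes to composition of linear maps. -/
noncomputable def phi (s : k) (c d : Fin 2 → k) :
    List Layer → ((List (Fin 2) →₀ k) →ₗ[k] (List (Fin 2) →₀ k))
  | [] => LinearMap.id
  | L :: T => phi s c d T ∘ₗ layerMap s c d L

/-- The value on a diagram: the scalar by which `φ` of the diagram acts on `k`, which has the empty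
word as its basis. -/
noncomputable def Q (s : k) (c d : Fin 2 → k) (D : Diagram) : k :=
  phi s c d D.layers (Finsupp.single [] 1) []

/-- Generators of `U_q(sl_2)`: the algebra generated by `E`, `F`, `K`, `K⁻¹` with
`K E K⁻¹ = q E`, `K F K⁻¹ = q⁻¹ F`, `E F - F E = (K - K⁻¹) / (q^{1/2} - q^{-1/2})`, and coproduct
`E ↦ E ⊗ K + 1 ⊗ E`, `F ↦ F ⊗ 1 + K⁻¹ ⊗ F`, `K ↦ K ⊗ K`. -/
inductive Gen
  | E
  | F
  | K
  | Kinv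
  deriving DecidableEq

/-- The generators on the standard representation `V`: `E e_2 = e_1`, `F e_1 = e_2`,
`K e_1 = q^{1/2} e_1`, `K e_2 = q^{-1/2} e_2`. -/
def genMat (s : k) : Gen → Matrix (Fin 2) (Fin 2) k
  | .E => !![0, 1; 0, 0]
  | .F => !![0, 0; 1, 0]
  | .K => !![s ^ 2, 0; 0, (s ^ 2)⁻¹]
  | .Kinv => !![(s ^ 2)⁻¹, 0; 0, s ^ 2]

/-- The antipode on generators, as matrices on `V`:
`S E = - E K⁻¹`, `S F = - K F`, `S K = K⁻¹`. -/
def antipodeMat (s : k) : Gen → Matrix (Fin 2) (Fin 2) k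
  | .E => -(genMat s .E * genMat s .Kinv)
  | .F => -(genMat s .K * genMat s .F)
  | .K => genMat s .Kinv
  | .Kinv => genMat s .K

/-- The generators on `V` (`down`) and on its dual `V*` (`up`), where `X` acts by the transpose
of `S X`. -/
def dirMat (s : k) : Dir → Gen → Matrix (Fin 2) (Fin 2) k
  | .down, X => genMat s X
  | .up, X => (antipodeMat s X).transpose

/-- For a matrix `A` and a vector `v` of a tensor product, the vector `A e_i ⊗ v`. -/
noncomputable def consMat (A : Matrix (Fin 2) (Fin 2) k) (i : Fin 2) (v : List (Fin 2) →₀ k) :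
    List (Fin 2) →₀ k :=
  ∑ j, A j i • v.mapDomain (List.cons j)

/-- The action of a generator on the basis vectors of the tensor product with strands `w`, through
the counit for the empty product and through the coproduct otherwise. -/
noncomputable def tensorAct (s : k) : Gen → List Dir → List (Fin 2) → (List (Fin 2) →₀ k)
  | .E, a :: w, i :: x => consMat (dirMat s a .E) i (tensorAct s .K w x) +
      consMat 1 i (tensorAct s .E w x)
  | .F, a :: w, i :: x => consMat (dirMat s a .F) i (Finsupp.single x 1) +
      consMat (dirMat s a .Kinv) i (tensorAct s .F w x)
  | .K, a :: w, i :: x => consMat (dirMat s a .K) i (tensorAct s .K w x)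
  | .Kinv, a :: w, i :: x => consMat (dirMat s a .Kinv) i (tensorAct s .Kinv w x)
  | .K, [], [] => Finsupp.single [] 1
  | .Kinv, [], [] => Finsupp.single [] 1
  | _, _, _ => 0

/-- The linear map assigned to a piece by `φ` commutes with the action of `U_q(sl_2)`. -/
def IsUqLinear (s : k) (c d : Fin 2 → k) (g : Elem) : Prop :=
  ∀ (X : Gen) (x : List (Fin 2)), x.length = g.src.length →
    Finsupp.linearCombination k (pieceMap s c d g) (tensorAct s X g.src x) =
      Finsupp.linearCombination k (tensorAct s X g.tgt) (pieceMap s c d g x)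

end Assignment

/-! ## Local relations between diagrams -/

/-- `Differ A B D D'`: the diagrams `D` and `D'` agree except that, at one place, `D` has the layers
`A` where `D'` has the layers `B`. -/
def Differ (A B : List Layer) (D D' : Diagram) : Prop :=
  ∃ top bot, D.layers = top ++ A ++ bot ∧ D'.layers = top ++ B ++ bot

/-- The type of the positive crossing with strands of directions `a` and `b`. -/
def posOver : Dir → Dir → Over
  | .down, .down => .slash
  | .up, .up => .slash
  | .down, .up => .back
  | .up, .down => .back

/-- The oriented smoothing of a crossing with strands of directions `a` and `b`. -/
def smoothing (a b : Dir) (l r : List Dir) : List Layer :=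
  if a = b then [] else [⟨l, .ev a, r⟩, ⟨l, .coev b, r⟩]

/-- The diagrams `Dp`, `Dm`, `D₀` agree except at one place, where `Dp` has a positive crossing,
`Dm` the negative crossing, and `D₀` the oriented smoothing. -/
def IsSkeinTriple (Dp Dm D₀ : Diagram) : Prop :=
  ∃ (top bot : List Layer) (l r : List Dir) (a b : Dir),
    Dp.layers = top ++ [⟨l, .cross (posOver a b) a b, r⟩] ++ bot ∧
    Dm.layers = top ++ [⟨l, .cross (posOver a b).flip a b, r⟩] ++ bot ∧
    D₀.layers = top ++ smoothing a b l r ++ bot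

/-- `D` is `D'` with a small circle (without crossings) added. -/
def AddsCircle (D D' : Diagram) : Prop :=
  ∃ (l r : List Dir) (a : Dir), Differ [⟨l, .coev a, r⟩, ⟨l, .ev a, r⟩] [] D D'

/-- `D` is `D'` with a curl added; the curl is positive for `o = slash`, negative for
`o = back`. -/
def AddsCurl (o : Over) (D D' : Diagram) : Prop :=
  ∃ (l r : List Dir) (a : Dir), Differ (curlRight o a l r) [] D D' ∨
    Differ (curlLeft o a l r) [] D D'

/-- The trivial knotoid diagram: a vertical segment. -/
def trivialDiagram : Diagram where
  layers := [⟨[], .leg, []⟩, ⟨[], .head, []⟩]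
  isTangle := ⟨rfl, rfl, rfl⟩
  one_leg := by decide
  one_head := by decide

end TriKnotoid

/-! Every assertion about `Q` is local: a linear relation between the maps of two or three small
tangles has to survive the addition of vertical strands at the sides and of layers above and below.
Since `phi` sends juxtaposition to tensor product and stacking to composition, this holds for all
relations at once (`phi_whisker`, `LinRel.Q_eq`), and it remains to verify each relation on the
basis words of a tangle without extra strands.

Exchanging heights is the interchange law `(f ⊗ id) ∘ (id ⊗ g) = (id ⊗ g) ∘ (f ⊗ id)`, valid for
arbitrary linear maps (`phi_exchange`). The other moves contain no end-point and involve at most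
three strands, so they are finite computations with explicit tables: duality of maxima and minima,
compatibility of the mixed crossings with rotation, invertibility, and the Yang–Baxter equation. A
curl acts as the scalar `s ^ 3` or `(s ^ 3)⁻¹`, the same on both sides of a strand; so it may change
sides, though in general it may not be removed. As no move takes a strand across an end-point, the
vectors `c` and `d` are subject to no condition.

The skein relation is the Hecke relation for `s • R s`, rotated when the two strands have different
directions. Compatibility with `U_q(sl_2)` is checked on generators and basis words.

One technical point: `layerMap` is defined by cutting words at fixed places and has no meaning on
words of the wrong length. Vectors are therefore kept in `words k n`, where `n` is the number of
strands; directions do not affect the underlying space. -/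

namespace TriKnotoid

section Assignment

variable {k : Type*} [Field k]

/-! ### Words of a fixed length -/

/-- The span of the words of length `n`. -/
def words (k : Type*) [Field k] (n : ℕ) : Submodule k (List (Fin 2) →₀ k) :=
  Finsupp.supported k k {x | x.length = n}

theorem single_mem_words {n : ℕ} {x : List (Fin 2)} (hx : x.length = n) (a : k) :
    Finsupp.single x a ∈ words k n :=
  Finsupp.single_mem_supported k a hx

/-- This reduces an identity of maps to basis words of the right length, so the values on all other
words never matter. -/
theorem eqOn_words {M : Type*} [AddCommGroup M] [Module k M] {n : ℕ}
    {f g : (List (Fin 2) →₀ k) →ₗ[k] M}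
    (h : ∀ x : List (Fin 2), x.length = n → f (Finsupp.single x 1) = g (Finsupp.single x 1))
    {v : List (Fin 2) →₀ k} (hv : v ∈ words k n) : f v = g v := by
  rw [words, Finsupp.supported_eq_span_single] at hv
  refine LinearMap.eqOn_span (s := (fun i => Finsupp.single i (1 : k)) '' _) ?_ hv
  rintro _ ⟨x, hx, rfl⟩
  exact h x hx

theorem map_words_le {n m : ℕ} {f : (List (Fin 2) →₀ k) →ₗ[k] (List (Fin 2) →₀ k)}
    (h : ∀ x : List (Fin 2), x.length = n → f (Finsupp.single x 1) ∈ words k m)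
    {v : List (Fin 2) →₀ k} (hv : v ∈ words k n) : f v ∈ words k m := by
  rw [words, Finsupp.supported_eq_span_single] at hv
  have : Submodule.span k ((fun i => Finsupp.single i (1 : k)) '' {x | x.length = n}) ≤
      (words k m).comap f := by
    rw [Submodule.span_le]
    rintro _ ⟨x, hx, rfl⟩
    exact h x hx
  exact this hv

/-- The embedding `v ↦ x ⊗ v ⊗ z` of words. -/
noncomputable def whisker (k : Type*) [Field k] (x z : List (Fin 2)) :
    (List (Fin 2) →₀ k) →ₗ[k] (List (Fin 2) →₀ k) :=
  Finsupp.lmapDomain k k fun y => x ++ y ++ z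

@[simp]
theorem whisker_single (x y z : List (Fin 2)) (a : k) :
    whisker k x z (Finsupp.single y a) = Finsupp.single (x ++ y ++ z) a := by
  simp [whisker, Finsupp.mapDomain_single]

theorem whisker_whisker (x x' z z' : List (Fin 2)) (v : List (Fin 2) →₀ k) :
    whisker k x z (whisker k x' z' v) = whisker k (x ++ x') (z' ++ z) v := by
  rw [whisker, whisker, whisker, Finsupp.lmapDomain_apply, Finsupp.lmapDomain_apply,
    Finsupp.lmapDomain_apply, ← Finsupp.mapDomain_comp]
  congr 1
  funext y
  simp

theorem whisker_mem_words {n : ℕ} {v : List (Fin 2) →₀ k} (hv : v ∈ words k n)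
    (x z : List (Fin 2)) : whisker k x z v ∈ words k (x.length + n + z.length) :=
  map_words_le (fun y hy => by
    rw [whisker_single]
    exact single_mem_words (by simp [hy, Nat.add_assoc]) _) hv

/-! ### Layers -/

/-- No condition on `x` is needed: on a word of the wrong length `pieceMap` has the default value
`0`, which lies in every `words k n`. -/
theorem pieceMap_mem_words (s : k) (c d : Fin 2 → k) (g : Elem) (x : List (Fin 2)) :
    pieceMap s c d g x ∈ words k g.tgt.length := by
  unfold pieceMap
  split
  · exact Submodule.sum_mem _ fun i _ => single_mem_words rfl _
  · exact single_mem_words rfl _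
  · exact Submodule.sum_mem _ fun i _ => single_mem_words rfl _
  · split_ifs
    · exact single_mem_words rfl _
    · exact Submodule.zero_mem _
  · exact Submodule.sum_mem _ fun i _ => Submodule.sum_mem _ fun i _ => single_mem_words rfl _
  · exact Submodule.zero_mem _

/-- This recovers the formula `id ⊗ g ⊗ id` from the definition by `take` and `drop`. The cuts
depend only on the lengths of `x` and `y`, so `z` is arbitrary and need not match `r`. -/
theorem layerMap_single (s : k) (c d : Fin 2 → k) (l r : List Dir) (g : Elem)
    {x y : List (Fin 2)} (hx : x.length = l.length) (hy : y.length = g.src.length)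
    (z : List (Fin 2)) (a : k) :
    layerMap s c d ⟨l, g, r⟩ (Finsupp.single (x ++ y ++ z) a) =
      a • whisker k x z (pieceMap s c d g y) := by
  have h1 : (x ++ (y ++ z)).drop (l.length + g.src.length) = z := by
    rw [← hx, ← hy, ← List.append_assoc, ← List.length_append, List.drop_left]
  rw [layerMap, Finsupp.linearCombination_single, List.append_assoc]
  simp only [h1]
  simp only [← hx, ← hy, List.drop_left, List.take_left]
  rfl

/-- The strands `l` move the cuts by exactly the length of the prefix `x`, so the piece still acts
on the same letters. -/
theorem layerMap_whisker (s : k) (c d : Fin 2 → k) (L : Layer) (l r : List Dir)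
    {x : List (Fin 2)} (hx : x.length = l.length) (z : List (Fin 2))
    {v : List (Fin 2) →₀ k} (hv : v ∈ words k L.src.length) :
    layerMap s c d ⟨l ++ L.left, L.piece, L.right ++ r⟩ (whisker k x z v) =
      whisker k x z (layerMap s c d L v) := by
  refine eqOn_words (f := layerMap s c d ⟨l ++ L.left, L.piece, L.right ++ r⟩ ∘ₗ whisker k x z)
    (g := whisker k x z ∘ₗ layerMap s c d L) ?_ hv
  intro u hu
  obtain ⟨L1, g, L2⟩ := L
  simp only [Layer.src, List.length_append] at hu
  obtain ⟨u1, u', rfl, hu1⟩ : ∃ u1 u', u = u1 ++ u' ∧ u1.length = L1.length :=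
    ⟨u.take L1.length, u.drop L1.length, (List.take_append_drop _ _).symm, by simp; omega⟩
  obtain ⟨u2, u3, rfl, hu2⟩ : ∃ u2 u3, u' = u2 ++ u3 ∧ u2.length = g.src.length :=
    ⟨u'.take g.src.length, u'.drop g.src.length, (List.take_append_drop _ _).symm, by
      simp at hu ⊢; omega⟩
  have e1 : x ++ (u1 ++ (u2 ++ u3)) ++ z = (x ++ u1) ++ u2 ++ (u3 ++ z) := by simp
  have e2 : u1 ++ (u2 ++ u3) = u1 ++ u2 ++ u3 := by simp
  rw [LinearMap.comp_apply, LinearMap.comp_apply, whisker_single, e1,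
    layerMap_single s c d _ _ g (by simp [hx, hu1]) hu2, e2, layerMap_single s c d _ _ g hu1 hu2,
    one_smul, one_smul, whisker_whisker]

theorem layerMap_mem_words (s : k) (c d : Fin 2 → k) (L : Layer) {v : List (Fin 2) →₀ k}
    (hv : v ∈ words k L.src.length) : layerMap s c d L v ∈ words k L.tgt.length := by
  refine map_words_le (fun u hu => ?_) hv
  simp only [Layer.src, List.length_append] at hu
  rw [layerMap, Finsupp.linearCombination_single, one_smul]
  have := whisker_mem_words (pieceMap_mem_words s c d L.piece
    ((u.drop L.left.length).take L.piece.src.length)) (u.take L.left.length)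
    (u.drop (L.left.length + L.piece.src.length))
  have e : L.tgt.length = (u.take L.left.length).length + L.piece.tgt.length +
      (u.drop (L.left.length + L.piece.src.length)).length := by
    simp [Layer.tgt]
    omega
  rw [e]
  exact this

/-! ### Stacks of layers -/

theorem phi_append (s : k) (c d : Fin 2 → k) (A B : List Layer) (v : List (Fin 2) →₀ k) :
    phi s c d (A ++ B) v = phi s c d B (phi s c d A v) := by
  induction A generalizing v with
  | nil => rfl
  | cons L A ih => exact ih _

theorem phi_mem_words (s : k) (c d : Fin 2 → k) {T : List Layer} {w w' : List Dir}
    (hT : IsTangle w T w') {v : List (Fin 2) →₀ k} (hv : v ∈ words k w.length) :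
    phi s c d T v ∈ words k w'.length := by
  induction T generalizing w v with
  | nil => cases hT; exact hv
  | cons L T ih =>
    obtain ⟨rfl, hT⟩ := hT
    exact ih hT (layerMap_mem_words s c d L hv)

end Assignment

theorem IsTangle.exists_of_append {A B : List Layer} {w w' : List Dir}
    (h : IsTangle w (A ++ B) w') : ∃ w₁, IsTangle w A w₁ ∧ IsTangle w₁ B w' := by
  induction A generalizing w with
  | nil => exact ⟨w, rfl, h⟩
  | cons L A ih =>
    obtain ⟨w₁, h1, h2⟩ := ih h.2
    exact ⟨w₁, ⟨h.1, h1⟩, h2⟩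

/-- The layer with further vertical strands to its left and to its right. -/
def Layer.whisker (l r : List Dir) (L : Layer) : Layer := ⟨l ++ L.left, L.piece, L.right ++ r⟩

section Assignment

variable {k : Type*} [Field k]

/-! ### Local relations and their extension to diagrams -/

theorem phi_whisker (s : k) (c d : Fin 2 → k) {T : List Layer} {w w' : List Dir}
    (hT : IsTangle w T w') (l r : List Dir) {x : List (Fin 2)} (hx : x.length = l.length)
    (z : List (Fin 2)) {v : List (Fin 2) →₀ k} (hv : v ∈ words k w.length) :
    phi s c d (T.map (Layer.whisker l r)) (whisker k x z v) = whisker k x z (phi s c d T v) := by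
  induction T generalizing w v with
  | nil => rfl
  | cons L T ih =>
    obtain ⟨rfl, hT⟩ := hT
    have := ih hT (layerMap_mem_words s c d L hv)
    rw [← layerMap_whisker s c d L l r hx z hv] at this
    exact this

/-- A linear relation `α φ(A) = β φ(B) + γ φ(C)` between tangle diagrams with the same strands at
the top. -/
def LinRel (s : k) (c d : Fin 2 → k) (w : List Dir) (α β γ : k) (A B C : List Layer) : Prop :=
  ∀ v ∈ words k w.length, α • phi s c d A v = β • phi s c d B v + γ • phi s c d C v

theorem linRel_of_basis {s : k} {c d : Fin 2 → k} {w : List Dir} {α β γ : k} {A B C : List Layer}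
    (h : ∀ y : List (Fin 2), y.length = w.length →
      α • phi s c d A (Finsupp.single y 1) =
        β • phi s c d B (Finsupp.single y 1) + γ • phi s c d C (Finsupp.single y 1)) :
    LinRel s c d w α β γ A B C := fun _ hv =>
  eqOn_words (f := α • phi s c d A) (g := β • phi s c d B + γ • phi s c d C) h hv

theorem LinRel.whisker {s : k} {c d : Fin 2 → k} {w wA wB wC : List Dir} {α β γ : k}
    {A B C : List Layer} (h : LinRel s c d w α β γ A B C) (hA : IsTangle w A wA)
    (hB : IsTangle w B wB) (hC : IsTangle w C wC) (l r : List Dir) :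
    LinRel s c d (l ++ w ++ r) α β γ (A.map (Layer.whisker l r)) (B.map (Layer.whisker l r))
      (C.map (Layer.whisker l r)) := by
  refine linRel_of_basis fun y hy => ?_
  simp only [List.length_append] at hy
  obtain ⟨x, u', rfl, hx⟩ : ∃ x u', y = x ++ u' ∧ x.length = l.length :=
    ⟨y.take l.length, y.drop l.length, (List.take_append_drop _ _).symm, by simp; omega⟩
  obtain ⟨u, z, rfl, hu⟩ : ∃ u z, u' = u ++ z ∧ u.length = w.length :=
    ⟨u'.take w.length, u'.drop w.length, (List.take_append_drop _ _).symm, by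
      simp at hy ⊢; omega⟩
  have hm := single_mem_words hu (1 : k)
  rw [← List.append_assoc, ← whisker_single, phi_whisker s c d hA l r hx z hm,
    phi_whisker s c d hB l r hx z hm, phi_whisker s c d hC l r hx z hm, ← map_smul, h _ hm,
    map_add, map_smul, map_smul]

/-- The locality principle: `top` produces a vector of the length at which the whiskered relation
applies, and `bot` preserves the relation by linearity. -/
theorem LinRel.Q_eq {s : k} {c d : Fin 2 → k} {w wA wB wC : List Dir} {α β γ : k}
    {A B C : List Layer} (h : LinRel s c d w α β γ A B C) (hA : IsTangle w A wA)
    (hB : IsTangle w B wB) (hC : IsTangle w C wC) (hne : A ≠ []) {DA DB DC : Diagram}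
    {top bot : List Layer} {l r : List Dir}
    (hDA : DA.layers = top ++ A.map (Layer.whisker l r) ++ bot)
    (hDB : DB.layers = top ++ B.map (Layer.whisker l r) ++ bot)
    (hDC : DC.layers = top ++ C.map (Layer.whisker l r) ++ bot) :
    α * Q s c d DA = β * Q s c d DB + γ * Q s c d DC := by
  have hT := DA.isTangle
  rw [hDA, List.append_assoc] at hT
  obtain ⟨w', htop, hmid⟩ := hT.exists_of_append
  -- The splitting gives only some word `w'` between `top` and the inserted layers. The source of
  -- the first layer of `A` identifies it, hence the condition `A ≠ []`.
  have hw : w' = l ++ w ++ r := by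
    obtain ⟨L, T, rfl⟩ := List.exists_cons_of_ne_nil hne
    rw [hmid.1, hA.1]
    simp [Layer.whisker, Layer.src]
  subst hw
  have key := h.whisker hA hB hC l r _
    (phi_mem_words s c d htop (single_mem_words (x := []) rfl (1 : k)))
  simp only [Q, hDA, hDB, hDC, phi_append]
  rw [← smul_eq_mul, ← smul_eq_mul, ← smul_eq_mul, ← Finsupp.smul_apply, ← Finsupp.smul_apply,
    ← Finsupp.smul_apply, ← map_smul, key, map_add, map_smul, map_smul, Finsupp.add_apply]

/-- A local relation `φ(A) = φ(B)`. -/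
theorem Q_eq_of_phi_eq {s : k} {c d : Fin 2 → k} {w wA wB : List Dir}
    {A B : List Layer}
    (h : ∀ y : List (Fin 2), y.length = w.length →
      phi s c d A (Finsupp.single y 1) = phi s c d B (Finsupp.single y 1))
    (hA : IsTangle w A wA) (hB : IsTangle w B wB) (hne : A ≠ [])
    {DA DB : Diagram} {top bot : List Layer} {l r : List Dir}
    (hDA : DA.layers = top ++ A.map (Layer.whisker l r) ++ bot)
    (hDB : DB.layers = top ++ B.map (Layer.whisker l r) ++ bot) :
    Q s c d DA = Q s c d DB := by
  -- The third term is a second copy of `B` with coefficient zero.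
  have hrel : LinRel s c d w 1 1 0 A B B :=
    linRel_of_basis fun y hy => by rw [h y hy, zero_smul, add_zero]
  have := hrel.Q_eq hA hB hB hne hDA hDB hDB
  simpa using this

/-- A local relation `φ(A) = β φ(B)`. -/
theorem Q_eq_mul_of_phi_eq_smul {s : k} {c d : Fin 2 → k} {w wA wB : List Dir} {β : k}
    {A B : List Layer}
    (h : ∀ y : List (Fin 2), y.length = w.length →
      phi s c d A (Finsupp.single y 1) = β • phi s c d B (Finsupp.single y 1))
    (hA : IsTangle w A wA) (hB : IsTangle w B wB) (hne : A ≠ [])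
    {DA DB : Diagram} {top bot : List Layer} {l r : List Dir}
    (hDA : DA.layers = top ++ A.map (Layer.whisker l r) ++ bot)
    (hDB : DB.layers = top ++ B.map (Layer.whisker l r) ++ bot) :
    Q s c d DA = β * Q s c d DB := by
  have hrel : LinRel s c d w 1 β 0 A B B :=
    linRel_of_basis fun y hy => by rw [h y hy, zero_smul, add_zero, one_smul]
  have := hrel.Q_eq hA hB hB hne hDA hDB hDB
  simpa using this

/-! ### Exchange of heights -/

/-- Both sides are the bilinear expression `v₁ ⊗ u ⊗ v₂`, expanded first in `v₁` and first in `v₂`.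
-/
theorem linearCombination_whisker_comm (u : List (Fin 2)) (v₁ v₂ : List (Fin 2) →₀ k) :
    Finsupp.linearCombination k (fun y => whisker k (y ++ u) [] v₂) v₁ =
      Finsupp.linearCombination k (fun y => whisker k [] (u ++ y) v₁) v₂ := by
  induction v₁ using Finsupp.induction_linear with
  | zero => simp [Finsupp.linearCombination_apply]
  | add f g hf hg =>
    rw [map_add, hf, hg]
    simp [Finsupp.linearCombination_apply, smul_add, Finsupp.sum_add]
  | single x a =>
    induction v₂ using Finsupp.induction_linear with
    | zero => simp
    | add f g hf hg =>
      rw [map_add, ← hf, ← hg]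
      simp
    | single y b => simp [mul_comm]

theorem phi_exchange (s : k) (c d : Fin 2 → k) (m : List Dir) (g h : Elem) (y : List (Fin 2))
    (hy : y.length = (g.src ++ m ++ h.src).length) :
    phi s c d [⟨[], g, m ++ h.src⟩, ⟨g.tgt ++ m, h, []⟩] (Finsupp.single y 1) =
      phi s c d [⟨g.src ++ m, h, []⟩, ⟨[], g, m ++ h.tgt⟩] (Finsupp.single y 1) := by
  simp only [List.length_append] at hy
  obtain ⟨y₁, u', rfl, h₁⟩ : ∃ y₁ u', y = y₁ ++ u' ∧ y₁.length = g.src.length :=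
    ⟨y.take g.src.length, y.drop g.src.length, (List.take_append_drop _ _).symm, by simp; omega⟩
  obtain ⟨u, y₂, rfl, hu⟩ : ∃ u y₂, u' = u ++ y₂ ∧ u.length = m.length :=
    ⟨u'.take m.length, u'.drop m.length, (List.take_append_drop _ _).symm, by
      simp at hy ⊢; omega⟩
  have h₂ : y₂.length = h.src.length := by simp at hy; omega
  -- The layer that acts second sees a vector, not a basis word. `left` and `right` expand its
  -- action linearly, for the two orders of the pieces.
  have left : ∀ v ∈ words k g.tgt.length,
      layerMap s c d ⟨g.tgt ++ m, h, []⟩ (whisker k [] (u ++ y₂) v) =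
        Finsupp.linearCombination k (fun y => whisker k (y ++ u) [] (pieceMap s c d h y₂)) v :=
    fun v hv => eqOn_words
      (f := layerMap s c d ⟨g.tgt ++ m, h, []⟩ ∘ₗ whisker k [] (u ++ y₂)) (fun y hy => by
        have := layerMap_single s c d (g.tgt ++ m) [] h (x := y ++ u) (by simp [hy, hu]) h₂ [] 1
        simpa using this) hv
  have right : ∀ v ∈ words k h.tgt.length,
      layerMap s c d ⟨[], g, m ++ h.tgt⟩ (whisker k (y₁ ++ u) [] v) =
        Finsupp.linearCombination k (fun y => whisker k [] (u ++ y) (pieceMap s c d g y₁)) v :=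
    fun v hv => eqOn_words
      (f := layerMap s c d ⟨[], g, m ++ h.tgt⟩ ∘ₗ whisker k (y₁ ++ u) []) (fun y hy => by
        have := layerMap_single s c d [] (m ++ h.tgt) g (x := []) rfl h₁ (u ++ y) 1
        simpa using this) hv
  have e₁ := layerMap_single s c d [] (m ++ h.src) g (x := []) rfl h₁ (u ++ y₂) 1
  have e₂ := layerMap_single s c d (g.src ++ m) [] h (x := y₁ ++ u) (by simp [h₁, hu]) h₂ [] 1
  simp only [List.nil_append, List.append_nil, one_smul, List.append_assoc] at e₁ e₂
  simp only [phi, LinearMap.comp_apply, LinearMap.id_apply, e₁, e₂]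
  have hl := left _ (pieceMap_mem_words s c d g y₁)
  have hr := right _ (pieceMap_mem_words s c d h y₂)
  rw [hl, hr, linearCombination_whisker_comm]

/-! ### The matrix `R` and its inverse -/

theorem R_inv {s : k} (hs : s ≠ 0) :
    (R s)⁻¹ = !![s⁻¹, 0, 0, 0; 0, s⁻¹ - s ^ 3, s, 0; 0, s, 0, 0; 0, 0, 0, s⁻¹] := by
  apply Matrix.inv_eq_right_inv
  ext i j
  fin_cases i <;> fin_cases j <;>
    simp [R, Matrix.mul_apply, Fin.sum_univ_four, hs]
  field_simp
  ring

theorem isUnit_R {s : k} (hs : s ≠ 0) : IsUnit (R s) := by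
  refine (Matrix.isUnit_iff_isUnit_det _).2 (isUnit_iff_ne_zero.2 ?_)
  simp [R, Matrix.det_succ_row_zero, Fin.sum_univ_succ, Fin.succAbove, hs]

/-- The matrix `R s` has the eigenvalues `s` and `-(s ^ 3)⁻¹`, so `T = s • R s` satisfies the Hecke
relation `(T - s ^ 2) (T + (s ^ 2)⁻¹) = 0`; this is `T - T⁻¹ = s ^ 2 - (s ^ 2)⁻¹`. The proof
compares entries. -/
theorem R_skein {s : k} (hs : s ≠ 0) :
    s • R s - s⁻¹ • (R s)⁻¹ = (s ^ 2 - (s ^ 2)⁻¹) • (1 : Matrix (Fin 4) (Fin 4) k) := by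
  rw [R_inv hs]
  ext i j
  fin_cases i <;> fin_cases j <;> simp [R] <;> field_simp <;> ring

theorem Rpow_slash (s : k) : Rpow s .slash =
    !![s, 0, 0, 0; 0, 0, s⁻¹, 0; 0, s⁻¹, s - (s ^ 3)⁻¹, 0; 0, 0, 0, s] := rfl

theorem Rpow_back {s : k} (hs : s ≠ 0) : Rpow s .back =
    !![s⁻¹, 0, 0, 0; 0, s⁻¹ - s ^ 3, s, 0; 0, s, 0, 0; 0, 0, 0, s⁻¹] := R_inv hs

theorem pos_val : pos 0 0 = 0 ∧ pos 0 1 = 1 ∧ pos 1 0 = 2 ∧ pos 1 1 = 3 := by decide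

/-! ### The values of `φ` on the pieces -/

theorem pieceMap_coev_down (s : k) (c d : Fin 2 → k) :
    pieceMap s c d (.coev .down) [] = Finsupp.single [0, 0] 1 + Finsupp.single [1, 1] 1 := by
  simp [pieceMap, coevCoeff]

theorem pieceMap_coev_up (s : k) (c d : Fin 2 → k) :
    pieceMap s c d (.coev .up) [] =
      (s ^ 2)⁻¹ • Finsupp.single [0, 0] 1 + s ^ 2 • Finsupp.single [1, 1] 1 := by
  simp [pieceMap, coevCoeff]

theorem pieceMap_ev_up (s : k) (c d : Fin 2 → k) :
    pieceMap s c d (.ev .up) [0, 0] = Finsupp.single [] 1 ∧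
    pieceMap s c d (.ev .up) [0, 1] = 0 ∧
    pieceMap s c d (.ev .up) [1, 0] = 0 ∧
    pieceMap s c d (.ev .up) [1, 1] = Finsupp.single [] 1 := by
  simp [pieceMap, evCoeff]

theorem pieceMap_ev_down (s : k) (c d : Fin 2 → k) :
    pieceMap s c d (.ev .down) [0, 0] = s ^ 2 • Finsupp.single [] 1 ∧
    pieceMap s c d (.ev .down) [0, 1] = 0 ∧
    pieceMap s c d (.ev .down) [1, 0] = 0 ∧
    pieceMap s c d (.ev .down) [1, 1] = (s ^ 2)⁻¹ • Finsupp.single [] 1 := by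
  simp [pieceMap, evCoeff]

theorem pieceMap_cross (s : k) (c d : Fin 2 → k) (o : Over) (a b : Dir) (i j : Fin 2) :
    pieceMap s c d (.cross o a b) [i, j] =
      crossCoeff s o a b i j 0 0 • Finsupp.single [0, 0] 1 +
      crossCoeff s o a b i j 0 1 • Finsupp.single [0, 1] 1 +
      (crossCoeff s o a b i j 1 0 • Finsupp.single [1, 0] 1 +
      crossCoeff s o a b i j 1 1 • Finsupp.single [1, 1] 1) := by
  simp [pieceMap, Fin.sum_univ_two]

/-- This and the next seven tables make all crossings explicit, so that later computations meet
neither `crossCoeff` nor a matrix inverse. Each table has exactly one row with two terms. -/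
theorem pieceMap_cross_slash_down_down (s : k) (c d : Fin 2 → k) :
    pieceMap s c d (.cross .slash .down .down) [0, 0] =
      s • Finsupp.single [0, 0] 1 ∧
    pieceMap s c d (.cross .slash .down .down) [0, 1] =
      s⁻¹ • Finsupp.single [1, 0] 1 ∧
    pieceMap s c d (.cross .slash .down .down) [1, 0] =
      s⁻¹ • Finsupp.single [0, 1] 1 + (s - (s ^ 3)⁻¹) • Finsupp.single [1, 0] 1 ∧
    pieceMap s c d (.cross .slash .down .down) [1, 1] =
      s • Finsupp.single [1, 1] 1 := by
  refine ⟨?_, ?_, ?_, ?_⟩ <;> simp [pieceMap_cross, crossCoeff, Rpow_slash, pos_val]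

theorem pieceMap_cross_slash_down_up {s : k} (hs : s ≠ 0) (c d : Fin 2 → k) :
    pieceMap s c d (.cross .slash .down .up) [0, 0] =
      s⁻¹ • Finsupp.single [0, 0] 1 ∧
    pieceMap s c d (.cross .slash .down .up) [0, 1] =
      s • Finsupp.single [1, 0] 1 ∧
    pieceMap s c d (.cross .slash .down .up) [1, 0] =
      s • Finsupp.single [0, 1] 1 ∧
    pieceMap s c d (.cross .slash .down .up) [1, 1] =
      ((s ^ 5)⁻¹ - s⁻¹) • Finsupp.single [0, 0] 1 + s⁻¹ • Finsupp.single [1, 1] 1 := by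
  refine ⟨?_, ?_, ?_, ?_⟩
  all_goals
    simp [pieceMap_cross, crossCoeff, Rpow_back hs, pos_val, Over.flip, coevCoeff, evCoeff,
      -Finsupp.smul_single]
  -- The row with two terms. Its extra coefficient is `(s ^ 2)⁻¹ * (s ^ 2)⁻¹ * (s⁻¹ - s ^ 3)`, with
  -- one factor from the maximum and one from the minimum that rotate the crossing.
  case refine_4 => match_scalars <;> field_simp
  all_goals field_simp

theorem pieceMap_cross_slash_up_down {s : k} (hs : s ≠ 0) (c d : Fin 2 → k) :
    pieceMap s c d (.cross .slash .up .down) [0, 0] =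
      s⁻¹ • Finsupp.single [0, 0] 1 + (s⁻¹ - s ^ 3) • Finsupp.single [1, 1] 1 ∧
    pieceMap s c d (.cross .slash .up .down) [0, 1] =
      s • Finsupp.single [1, 0] 1 ∧
    pieceMap s c d (.cross .slash .up .down) [1, 0] =
      s • Finsupp.single [0, 1] 1 ∧
    pieceMap s c d (.cross .slash .up .down) [1, 1] =
      s⁻¹ • Finsupp.single [1, 1] 1 := by
  refine ⟨?_, ?_, ?_, ?_⟩ <;> simp [pieceMap_cross, crossCoeff, Rpow_back hs, pos_val, Over.flip]

theorem pieceMap_cross_slash_up_up (s : k) (c d : Fin 2 → k) :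
    pieceMap s c d (.cross .slash .up .up) [0, 0] =
      s • Finsupp.single [0, 0] 1 ∧
    pieceMap s c d (.cross .slash .up .up) [0, 1] =
      (s - (s ^ 3)⁻¹) • Finsupp.single [0, 1] 1 + s⁻¹ • Finsupp.single [1, 0] 1 ∧
    pieceMap s c d (.cross .slash .up .up) [1, 0] =
      s⁻¹ • Finsupp.single [0, 1] 1 ∧
    pieceMap s c d (.cross .slash .up .up) [1, 1] =
      s • Finsupp.single [1, 1] 1 := by
  refine ⟨?_, ?_, ?_, ?_⟩ <;> simp [pieceMap_cross, crossCoeff, Rpow_slash, pos_val]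

theorem pieceMap_cross_back_down_down {s : k} (hs : s ≠ 0) (c d : Fin 2 → k) :
    pieceMap s c d (.cross .back .down .down) [0, 0] =
      s⁻¹ • Finsupp.single [0, 0] 1 ∧
    pieceMap s c d (.cross .back .down .down) [0, 1] =
      (s⁻¹ - s ^ 3) • Finsupp.single [0, 1] 1 + s • Finsupp.single [1, 0] 1 ∧
    pieceMap s c d (.cross .back .down .down) [1, 0] =
      s • Finsupp.single [0, 1] 1 ∧
    pieceMap s c d (.cross .back .down .down) [1, 1] =
      s⁻¹ • Finsupp.single [1, 1] 1 := by
  refine ⟨?_, ?_, ?_, ?_⟩ <;> simp [pieceMap_cross, crossCoeff, Rpow_back hs, pos_val]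

theorem pieceMap_cross_back_down_up {s : k} (hs : s ≠ 0) (c d : Fin 2 → k) :
    pieceMap s c d (.cross .back .down .up) [0, 0] =
      s • Finsupp.single [0, 0] 1 + (s ^ 5 - s) • Finsupp.single [1, 1] 1 ∧
    pieceMap s c d (.cross .back .down .up) [0, 1] =
      s⁻¹ • Finsupp.single [1, 0] 1 ∧
    pieceMap s c d (.cross .back .down .up) [1, 0] =
      s⁻¹ • Finsupp.single [0, 1] 1 ∧
    pieceMap s c d (.cross .back .down .up) [1, 1] =
      s • Finsupp.single [1, 1] 1 := by
  refine ⟨?_, ?_, ?_, ?_⟩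
  all_goals
    simp [pieceMap_cross, crossCoeff, Rpow_slash, pos_val, Over.flip, coevCoeff, evCoeff,
      -Finsupp.smul_single]
  case refine_1 => match_scalars <;> field_simp
  all_goals field_simp

theorem pieceMap_cross_back_up_down (s : k) (c d : Fin 2 → k) :
    pieceMap s c d (.cross .back .up .down) [0, 0] =
      s • Finsupp.single [0, 0] 1 ∧
    pieceMap s c d (.cross .back .up .down) [0, 1] =
      s⁻¹ • Finsupp.single [1, 0] 1 ∧
    pieceMap s c d (.cross .back .up .down) [1, 0] =
      s⁻¹ • Finsupp.single [0, 1] 1 ∧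
    pieceMap s c d (.cross .back .up .down) [1, 1] =
      (s - (s ^ 3)⁻¹) • Finsupp.single [0, 0] 1 + s • Finsupp.single [1, 1] 1 := by
  refine ⟨?_, ?_, ?_, ?_⟩ <;> simp [pieceMap_cross, crossCoeff, Rpow_slash, pos_val, Over.flip]

theorem pieceMap_cross_back_up_up {s : k} (hs : s ≠ 0) (c d : Fin 2 → k) :
    pieceMap s c d (.cross .back .up .up) [0, 0] =
      s⁻¹ • Finsupp.single [0, 0] 1 ∧
    pieceMap s c d (.cross .back .up .up) [0, 1] =
      s • Finsupp.single [1, 0] 1 ∧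
    pieceMap s c d (.cross .back .up .up) [1, 0] =
      s • Finsupp.single [0, 1] 1 + (s⁻¹ - s ^ 3) • Finsupp.single [1, 0] 1 ∧
    pieceMap s c d (.cross .back .up .up) [1, 1] =
      s⁻¹ • Finsupp.single [1, 1] 1 := by
  refine ⟨?_, ?_, ?_, ?_⟩ <;> simp [pieceMap_cross, crossCoeff, Rpow_back hs, pos_val]

/-! ### Layers with at most one strand on the left, on basis words -/

theorem layerMap_nil_cross (s : k) (c d : Fin 2 → k) (o : Over) (a b : Dir) (r : List Dir)
    (i j : Fin 2) (z : List (Fin 2)) :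
    layerMap s c d ⟨[], .cross o a b, r⟩ (Finsupp.single (i :: j :: z) 1) =
      whisker k [] z (pieceMap s c d (.cross o a b) [i, j]) := by
  simpa using layerMap_single s c d [] r (.cross o a b) (x := []) (y := [i, j]) rfl rfl z 1

theorem layerMap_cons_cross (s : k) (c d : Fin 2 → k) (e : Dir) (o : Over) (a b : Dir)
    (r : List Dir) (h i j : Fin 2) (z : List (Fin 2)) :
    layerMap s c d ⟨[e], .cross o a b, r⟩ (Finsupp.single (h :: i :: j :: z) 1) =
      whisker k [h] z (pieceMap s c d (.cross o a b) [i, j]) := by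
  simpa using layerMap_single s c d [e] r (.cross o a b) (x := [h]) (y := [i, j]) rfl rfl z 1

theorem layerMap_nil_ev (s : k) (c d : Fin 2 → k) (a : Dir) (r : List Dir)
    (i j : Fin 2) (z : List (Fin 2)) :
    layerMap s c d ⟨[], .ev a, r⟩ (Finsupp.single (i :: j :: z) 1) =
      whisker k [] z (pieceMap s c d (.ev a) [i, j]) := by
  simpa using layerMap_single s c d [] r (.ev a) (x := []) (y := [i, j]) rfl rfl z 1

theorem layerMap_cons_ev (s : k) (c d : Fin 2 → k) (e : Dir) (a : Dir)
    (r : List Dir) (h i j : Fin 2) (z : List (Fin 2)) :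
    layerMap s c d ⟨[e], .ev a, r⟩ (Finsupp.single (h :: i :: j :: z) 1) =
      whisker k [h] z (pieceMap s c d (.ev a) [i, j]) := by
  simpa using layerMap_single s c d [e] r (.ev a) (x := [h]) (y := [i, j]) rfl rfl z 1

theorem layerMap_nil_coev (s : k) (c d : Fin 2 → k) (a : Dir) (r : List Dir)
    (z : List (Fin 2)) :
    layerMap s c d ⟨[], .coev a, r⟩ (Finsupp.single z 1) =
      whisker k [] z (pieceMap s c d (.coev a) []) := by
  simpa using layerMap_single s c d [] r (.coev a) (x := []) (y := []) rfl rfl z 1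

theorem layerMap_cons_coev (s : k) (c d : Fin 2 → k) (e : Dir) (a : Dir)
    (r : List Dir) (h : Fin 2) (z : List (Fin 2)) :
    layerMap s c d ⟨[e], .coev a, r⟩ (Finsupp.single (h :: z) 1) =
      whisker k [h] z (pieceMap s c d (.coev a) []) := by
  simpa using layerMap_single s c d [e] r (.coev a) (x := [h]) (y := []) rfl rfl z 1

/-! ### The local relations on basis words -/

/-- Only the term of the maximum with the letter of the strand survives, and `coevCoeff s a.flip i *
evCoeff s a i = 1`. -/
theorem phi_zigzagRight {s : k} (hs : s ≠ 0) (c d : Fin 2 → k) (a : Dir)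
    (y : List (Fin 2)) (hy : y.length = 1) :
    phi s c d [⟨[a], .coev a.flip, []⟩, ⟨[], .ev a, [a]⟩] (Finsupp.single y 1) =
      phi s c d [] (Finsupp.single y 1) := by
  obtain ⟨i, rfl⟩ := List.length_eq_one_iff.1 hy
  simp only [phi, LinearMap.comp_apply, LinearMap.id_apply]
  cases a <;> fin_cases i <;>
    simp only [layerMap_nil_ev, layerMap_cons_coev, pieceMap_ev_down, pieceMap_ev_up,
      pieceMap_coev_down, pieceMap_coev_up, Dir.flip, map_add, map_smul, map_zero, whisker_single,
      List.cons_append, List.nil_append, smul_zero, add_zero, zero_add, Fin.zero_eta, Fin.mk_one]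
  all_goals match_scalars <;> try field_simp

theorem phi_zigzagLeft {s : k} (hs : s ≠ 0) (c d : Fin 2 → k) (a : Dir)
    (y : List (Fin 2)) (hy : y.length = 1) :
    phi s c d [⟨[], .coev a, [a]⟩, ⟨[a], .ev a.flip, []⟩] (Finsupp.single y 1) =
      phi s c d [] (Finsupp.single y 1) := by
  obtain ⟨i, rfl⟩ := List.length_eq_one_iff.1 hy
  simp only [phi, LinearMap.comp_apply, LinearMap.id_apply]
  cases a <;> fin_cases i <;>
    simp only [layerMap_cons_ev, layerMap_nil_coev, pieceMap_ev_down, pieceMap_ev_up,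
      pieceMap_coev_down, pieceMap_coev_up, Dir.flip, map_add, map_smul, map_zero, whisker_single,
      List.cons_append, List.nil_append, smul_zero, add_zero, zero_add, Fin.zero_eta, Fin.mk_one]
  all_goals match_scalars <;> try field_simp

/-- The crossings with upward strands are rotations of `R` and `R⁻¹`, and a quarter turn exchanges
`slash` and `back`. The finite check shows that these rotations are compatible for all directions.
-/
theorem phi_slideMin {s : k} (hs : s ≠ 0) (c d : Fin 2 → k) (o : Over) (a b : Dir)
    (y : List (Fin 2)) (hy : y.length = 3) :
    phi s c d [⟨[], .cross o b a, [b.flip]⟩, ⟨[a], .ev b, []⟩] (Finsupp.single y 1) =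
      phi s c d [⟨[b], .cross o.flip a b.flip, []⟩, ⟨[], .ev b, [a]⟩] (Finsupp.single y 1) := by
  obtain ⟨i, j, l, rfl⟩ := List.length_eq_three.1 hy
  simp only [phi, LinearMap.comp_apply, LinearMap.id_apply]
  cases o <;> cases a <;> cases b <;> fin_cases i <;> fin_cases j <;> fin_cases l <;>
    simp only [layerMap_nil_cross, layerMap_cons_cross, layerMap_nil_ev, layerMap_cons_ev,
      pieceMap_cross_slash_down_down, pieceMap_cross_slash_down_up hs,
      pieceMap_cross_slash_up_down hs, pieceMap_cross_slash_up_up, pieceMap_cross_back_down_down hs,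
      pieceMap_cross_back_down_up hs, pieceMap_cross_back_up_down, pieceMap_cross_back_up_up hs,
      pieceMap_ev_down, pieceMap_ev_up, Dir.flip, Over.flip, map_add, map_smul, map_zero,
      whisker_single, List.cons_append, List.nil_append, smul_zero, add_zero, zero_add,
      Fin.zero_eta, Fin.mk_one]
  all_goals match_scalars <;> try field_simp

theorem phi_slideMax {s : k} (hs : s ≠ 0) (c d : Fin 2 → k) (o : Over) (a b : Dir)
    (y : List (Fin 2)) (hy : y.length = 1) :
    phi s c d [⟨[a], .coev b, []⟩, ⟨[], .cross o a b, [b.flip]⟩] (Finsupp.single y 1) =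
      phi s c d [⟨[], .coev b, [a]⟩, ⟨[b], .cross o.flip b.flip a, []⟩] (Finsupp.single y 1) := by
  obtain ⟨i, rfl⟩ := List.length_eq_one_iff.1 hy
  simp only [phi, LinearMap.comp_apply, LinearMap.id_apply]
  cases o <;> cases a <;> cases b <;> fin_cases i <;>
    simp only [layerMap_nil_cross, layerMap_cons_cross, layerMap_nil_coev, layerMap_cons_coev,
      pieceMap_cross_slash_down_down, pieceMap_cross_slash_down_up hs,
      pieceMap_cross_slash_up_down hs, pieceMap_cross_slash_up_up, pieceMap_cross_back_down_down hs,
      pieceMap_cross_back_down_up hs, pieceMap_cross_back_up_down, pieceMap_cross_back_up_up hs,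
      pieceMap_coev_down, pieceMap_coev_up, Dir.flip, Over.flip, map_add, map_smul, whisker_single,
      List.cons_append, List.nil_append, smul_add, Fin.zero_eta, Fin.mk_one]
  all_goals match_scalars <;> try field_simp

/-- The factor by which a curl multiplies the value of a diagram. -/
def curlFactor (s : k) : Over → k
  | .slash => s ^ 3
  | .back => (s ^ 3)⁻¹

/-- A curl is a partial trace of the crossing, weighted by the coefficients of the maximum and the
minimum. For a positive curl on a downward strand, `e_1` receives `s * s ^ 2`, and `e_2` receives
`(s - (s ^ 3)⁻¹) * s ^ 2 + s * (s ^ 2)⁻¹`, which is again `s ^ 3`. -/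
theorem phi_curlRight {s : k} (hs : s ≠ 0) (c d : Fin 2 → k) (o : Over) (a : Dir)
    (y : List (Fin 2)) (hy : y.length = 1) :
    phi s c d (curlRight o a [] []) (Finsupp.single y 1) =
      curlFactor s o • phi s c d [] (Finsupp.single y 1) := by
  obtain ⟨i, rfl⟩ := List.length_eq_one_iff.1 hy
  simp only [curlRight, phi, LinearMap.comp_apply, LinearMap.id_apply]
  cases o <;> cases a <;> fin_cases i <;>
    simp only [layerMap_nil_cross, layerMap_cons_ev, layerMap_cons_coev,
      pieceMap_cross_slash_down_down, pieceMap_cross_slash_up_up, pieceMap_cross_back_down_down hs,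
      pieceMap_cross_back_up_up hs, pieceMap_ev_down, pieceMap_ev_up, pieceMap_coev_down,
      pieceMap_coev_up, Dir.flip, map_add, map_smul, map_zero, whisker_single, List.cons_append,
      List.nil_append, smul_add, smul_zero, add_zero, zero_add, Fin.zero_eta, Fin.mk_one,
      curlFactor]
  all_goals match_scalars <;> (try field_simp) <;> (try ring)

theorem phi_curlLeft {s : k} (hs : s ≠ 0) (c d : Fin 2 → k) (o : Over) (a : Dir)
    (y : List (Fin 2)) (hy : y.length = 1) :
    phi s c d (curlLeft o a [] []) (Finsupp.single y 1) =
      curlFactor s o • phi s c d [] (Finsupp.single y 1) := by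
  obtain ⟨i, rfl⟩ := List.length_eq_one_iff.1 hy
  simp only [curlLeft, phi, LinearMap.comp_apply, LinearMap.id_apply]
  cases o <;> cases a <;> fin_cases i <;>
    simp only [layerMap_cons_cross, layerMap_nil_ev, layerMap_nil_coev,
      pieceMap_cross_slash_down_down, pieceMap_cross_slash_up_up, pieceMap_cross_back_down_down hs,
      pieceMap_cross_back_up_up hs, pieceMap_ev_down, pieceMap_ev_up, pieceMap_coev_down,
      pieceMap_coev_up, Dir.flip, map_add, map_smul, map_zero, whisker_single, List.cons_append,
      List.nil_append, smul_add, smul_zero, add_zero, zero_add, Fin.zero_eta, Fin.mk_one,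
      curlFactor]
  all_goals match_scalars <;> (try field_simp) <;> (try ring)

theorem phi_circle {s : k} (hs : s ≠ 0) (c d : Fin 2 → k) (a : Dir)
    (y : List (Fin 2)) (hy : y.length = 0) :
    phi s c d [⟨[], .coev a, []⟩, ⟨[], .ev a, []⟩] (Finsupp.single y 1) =
      (s ^ 2 + (s ^ 2)⁻¹) • phi s c d [] (Finsupp.single y 1) := by
  obtain rfl := List.length_eq_zero_iff.1 hy
  simp only [phi, LinearMap.comp_apply, LinearMap.id_apply]
  cases a <;>
    simp only [layerMap_nil_ev, layerMap_nil_coev, pieceMap_ev_down, pieceMap_ev_up,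
      pieceMap_coev_down, pieceMap_coev_up, map_add, map_smul, whisker_single, List.cons_append,
      List.nil_append]
  all_goals match_scalars <;> (try field_simp) <;> (try ring)

theorem phi_R2 {s : k} (hs : s ≠ 0) (c d : Fin 2 → k) (o : Over) (a b : Dir)
    (y : List (Fin 2)) (hy : y.length = 2) :
    phi s c d [⟨[], .cross o a b, []⟩, ⟨[], .cross o.flip b a, []⟩] (Finsupp.single y 1) =
      phi s c d [] (Finsupp.single y 1) := by
  obtain ⟨i, j, rfl⟩ := List.length_eq_two.1 hy
  simp only [phi, LinearMap.comp_apply, LinearMap.id_apply]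
  cases o <;> cases a <;> cases b <;> fin_cases i <;> fin_cases j <;>
    simp only [layerMap_nil_cross, pieceMap_cross_slash_down_down, pieceMap_cross_slash_down_up hs,
      pieceMap_cross_slash_up_down hs, pieceMap_cross_slash_up_up, pieceMap_cross_back_down_down hs,
      pieceMap_cross_back_down_up hs, pieceMap_cross_back_up_down, pieceMap_cross_back_up_up hs,
      Over.flip, map_add, map_smul, whisker_single, List.cons_append, List.nil_append, smul_add,
      Fin.zero_eta, Fin.mk_one]
  all_goals match_scalars <;> (try field_simp) <;> (try ring)

set_option maxHeartbeats 4000000 in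
-- The Yang–Baxter equation, verified separately for each choice of directions and crossing type.
theorem phi_R3 {s : k} (hs : s ≠ 0) (c d : Fin 2 → k) (o : Over) (a b e : Dir)
    (y : List (Fin 2)) (hy : y.length = 3) :
    phi s c d [⟨[], .cross o a b, [e]⟩, ⟨[b], .cross o a e, []⟩, ⟨[], .cross o b e, [a]⟩]
        (Finsupp.single y 1) =
      phi s c d [⟨[a], .cross o b e, []⟩, ⟨[], .cross o a e, [b]⟩, ⟨[e], .cross o a b, []⟩]
        (Finsupp.single y 1) := by
  obtain ⟨i, j, l, rfl⟩ := List.length_eq_three.1 hy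
  simp only [phi, LinearMap.comp_apply, LinearMap.id_apply]
  cases o <;> cases a <;> cases b <;> cases e <;> fin_cases i <;> fin_cases j <;> fin_cases l <;>
    simp only [layerMap_nil_cross, layerMap_cons_cross, pieceMap_cross_slash_down_down,
      pieceMap_cross_slash_down_up hs, pieceMap_cross_slash_up_down hs, pieceMap_cross_slash_up_up,
      pieceMap_cross_back_down_down hs, pieceMap_cross_back_down_up hs, pieceMap_cross_back_up_down,
      pieceMap_cross_back_up_up hs, map_add, map_smul, whisker_single, List.cons_append,
      List.nil_append, smul_add, Fin.zero_eta, Fin.mk_one]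
  all_goals match_scalars <;> (try field_simp) <;> (try ring)

/-- For equal directions this is `R_skein` or its transpose, read on basis words. For different
directions it is a rotated form, in which the identity of `V ⊗ V` becomes a minimum followed by a
maximum. -/
theorem phi_skein {s : k} (hs : s ≠ 0) (c d : Fin 2 → k) (a b : Dir)
    (y : List (Fin 2)) (hy : y.length = 2) :
    s • phi s c d [⟨[], .cross (posOver a b) a b, []⟩] (Finsupp.single y 1) =
      s⁻¹ • phi s c d [⟨[], .cross (posOver a b).flip a b, []⟩] (Finsupp.single y 1) +
      (s ^ 2 - (s ^ 2)⁻¹) • phi s c d (smoothing a b [] []) (Finsupp.single y 1) := by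
  obtain ⟨i, j, rfl⟩ := List.length_eq_two.1 hy
  cases a <;> cases b <;> simp only [smoothing, if_true, reduceCtorEq, if_false, phi,
      LinearMap.comp_apply, LinearMap.id_apply, posOver]
  all_goals fin_cases i <;> fin_cases j <;>
    simp only [layerMap_nil_cross, layerMap_nil_ev, layerMap_nil_coev,
      pieceMap_cross_slash_down_down, pieceMap_cross_slash_down_up hs,
      pieceMap_cross_slash_up_down hs, pieceMap_cross_slash_up_up, pieceMap_cross_back_down_down hs,
      pieceMap_cross_back_down_up hs, pieceMap_cross_back_up_down, pieceMap_cross_back_up_up hs,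
      pieceMap_ev_down, pieceMap_ev_up, pieceMap_coev_down, pieceMap_coev_up, Over.flip, map_add,
      map_smul, map_zero, whisker_single, List.cons_append, List.nil_append, smul_add, smul_zero,
      add_zero, Fin.zero_eta, Fin.mk_one]
  all_goals match_scalars <;> (try field_simp) <;> (try ring)

/-! ### Compatibility with the action of `U_q(sl_2)` -/

theorem consMat_eq (A : Matrix (Fin 2) (Fin 2) k) (i : Fin 2) (v : List (Fin 2) →₀ k) :
    consMat A i v = A 0 i • whisker k [0] [] v + A 1 i • whisker k [1] [] v := by
  simp [consMat, Fin.sum_univ_two, whisker]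

/-- The source is the trivial module: `K` and `Kinv` fix the empty word, and `E` and `F` kill it
through the default case of `tensorAct`. The image of a maximum thus has to be an invariant vector.
-/
theorem isUqLinear_coev {s : k} (hs : s ≠ 0) (c d : Fin 2 → k) (a : Dir) :
    IsUqLinear s c d (.coev a) := by
  intro X y hy
  obtain rfl := List.length_eq_zero_iff.1 hy
  cases a <;> cases X <;>
    simp only [pieceMap_coev_down, pieceMap_coev_up, Elem.src, Elem.tgt, tensorAct, Dir.flip,
      consMat_eq, dirMat, antipodeMat, genMat, map_add, map_smul, map_zero,
      Finsupp.linearCombination_single, one_smul] <;>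
    simp [-Finsupp.smul_single]
  all_goals match_scalars <;> field_simp <;> try ring

theorem isUqLinear_ev {s : k} (hs : s ≠ 0) (c d : Fin 2 → k) (a : Dir) :
    IsUqLinear s c d (.ev a) := by
  intro X y hy
  obtain ⟨i, j, rfl⟩ := List.length_eq_two.1 hy
  cases a <;> fin_cases i <;> fin_cases j <;> cases X <;>
    simp [pieceMap_ev_down, pieceMap_ev_up, Elem.src, Elem.tgt, tensorAct, Dir.flip,
      consMat_eq, dirMat, antipodeMat, genMat, -Finsupp.smul_single]
  all_goals
    match_scalars
    field_simp
    try ring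

set_option maxHeartbeats 4000000 in
theorem isUqLinear_cross {s : k} (hs : s ≠ 0) (c d : Fin 2 → k) (o : Over) (a b : Dir) :
    IsUqLinear s c d (.cross o a b) := by
  intro X y hy
  obtain ⟨i, j, rfl⟩ := List.length_eq_two.1 hy
  cases o <;> cases a <;> cases b <;> fin_cases i <;> fin_cases j <;> cases X <;>
    simp [pieceMap_cross_slash_down_down,
      pieceMap_cross_slash_down_up hs, pieceMap_cross_slash_up_down hs,
      pieceMap_cross_slash_up_up, pieceMap_cross_back_down_down hs,
      pieceMap_cross_back_down_up hs, pieceMap_cross_back_up_down,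
      pieceMap_cross_back_up_up hs, Elem.src, Elem.tgt, tensorAct,
      consMat_eq, dirMat, antipodeMat, genMat, -Finsupp.smul_single]
  all_goals match_scalars <;> field_simp <;> try ring

theorem isUqLinear {s : k} (hs : s ≠ 0) (c d : Fin 2 → k) (g : Elem) (hg : ¬ g.IsEndpoint) :
    IsUqLinear s c d g := by
  cases g with
  | leg => exact absurd (Or.inl rfl) hg
  | head => exact absurd (Or.inr rfl) hg
  | coev a => exact isUqLinear_coev hs c d a
  | ev a => exact isUqLinear_ev hs c d a
  | cross o a b => exact isUqLinear_cross hs c d o a b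

/-! ### Invariance and the relations for whole diagrams -/

theorem Q_eq_of_move {s : k} (hs : s ≠ 0) (c d : Fin 2 → k) {A B : List Layer} (h : Move A B)
    {D D' : Diagram} {top bot : List Layer} (hD : D.layers = top ++ A ++ bot)
    (hD' : D'.layers = top ++ B ++ bot) : Q s c d D = Q s c d D' := by
  cases h with
  | exchange l m r g h _ =>
    exact Q_eq_of_phi_eq (phi_exchange s c d m g h) (wB := g.tgt ++ m ++ h.tgt)
      ⟨by simp [Layer.src], by simp [Layer.src, Layer.tgt], rfl⟩
      ⟨by simp [Layer.src], by simp [Layer.src, Layer.tgt], by simp [Layer.tgt, IsTangle]⟩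
      (by simp) (l := l) (r := r)
      (by simpa [Layer.whisker] using hD) (by simpa [Layer.whisker] using hD')
  | zigzagRight l r a =>
    -- The two layers fit together because `a.flip.flip = a`, which is definitional only after
    -- splitting into the two directions.
    exact Q_eq_of_phi_eq (phi_zigzagRight hs c d a)
      (w := [a]) ⟨rfl, by cases a <;> rfl, rfl⟩ rfl (by simp)
      (l := l) (r := r)
      (by simpa [Layer.whisker] using hD) (by simpa using hD')
  | zigzagLeft l r a =>
    exact Q_eq_of_phi_eq (phi_zigzagLeft hs c d a)
      (w := [a]) ⟨rfl, by cases a <;> rfl, rfl⟩ rfl (by simp)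
      (l := l) (r := r)
      (by simpa [Layer.whisker] using hD) (by simpa using hD')
  | slideMin l r o a b =>
    exact Q_eq_of_phi_eq (phi_slideMin hs c d o a b)
      (w := [b, a, b.flip]) ⟨rfl, rfl, rfl⟩ ⟨rfl, rfl, rfl⟩ (by simp)
      (l := l) (r := r)
      (by simpa [Layer.whisker] using hD) (by simpa [Layer.whisker] using hD')
  | slideMax l r o a b =>
    exact Q_eq_of_phi_eq (phi_slideMax hs c d o a b)
      (w := [a]) ⟨rfl, rfl, rfl⟩ ⟨rfl, rfl, rfl⟩ (by simp)
      (l := l) (r := r)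
      (by simpa [Layer.whisker] using hD) (by simpa [Layer.whisker] using hD')
  | R1' l r o a =>
    -- Both curls equal the same scalar `curlFactor s o` times the identity.
    exact Q_eq_of_phi_eq (w := [a]) (wA := [a]) (wB := [a])
      (fun y hy => (phi_curlRight hs c d o a y hy).trans (phi_curlLeft hs c d o a y hy).symm)
      ⟨rfl, rfl, rfl, rfl⟩
      ⟨rfl, by cases a <;> rfl, by cases a <;> rfl, rfl⟩ (by simp [curlRight])
      (l := l) (r := r) (by simpa [curlRight, Layer.whisker] using hD)
      (by simpa [curlLeft, Layer.whisker] using hD')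
  | R2 l r o a b =>
    exact Q_eq_of_phi_eq (phi_R2 hs c d o a b) (w := [a, b]) ⟨rfl, rfl, rfl⟩ rfl (by simp)
      (l := l) (r := r)
      (by simpa [Layer.whisker] using hD) (by simpa using hD')
  | R3 l r o a b e =>
    exact Q_eq_of_phi_eq (phi_R3 hs c d o a b e)
      (w := [a, b, e]) ⟨rfl, rfl, rfl, rfl⟩ ⟨rfl, rfl, rfl, rfl⟩ (by simp)
      (l := l) (r := r)
      (by simpa [Layer.whisker] using hD) (by simpa [Layer.whisker] using hD')

theorem Q_eq_of_triframedEquiv {s : k} (hs : s ≠ 0) (c d : Fin 2 → k) {D D' : Diagram}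
    (h : TriframedEquiv D D') : Q s c d D = Q s c d D' := by
  induction h with
  | rel _ _ h =>
    obtain ⟨_, _, _, _, hm, hD, hD'⟩ := h
    exact Q_eq_of_move hs c d hm hD hD'
  | refl => rfl
  | symm _ _ _ ih => exact ih.symm
  | trans _ _ _ _ _ ih₁ ih₂ => exact ih₁.trans ih₂

theorem Q_skein {s : k} (hs : s ≠ 0) (c d : Fin 2 → k) {Dp Dm D₀ : Diagram}
    (h : IsSkeinTriple Dp Dm D₀) :
    s * Q s c d Dp - s⁻¹ * Q s c d Dm = (s ^ 2 - (s ^ 2)⁻¹) * Q s c d D₀ := by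
  obtain ⟨top, bot, l, r, a, b, hp, hm, h₀⟩ := h
  have hrel : LinRel s c d [a, b] s s⁻¹ (s ^ 2 - (s ^ 2)⁻¹)
      [⟨[], .cross (posOver a b) a b, []⟩] [⟨[], .cross (posOver a b).flip a b, []⟩]
      (smoothing a b [] []) := linRel_of_basis (phi_skein hs c d a b)
  -- The smoothing also leads from `[a, b]` to `[b, a]`: for `a = b` it is empty, and otherwise `b =
  -- a.flip`.
  have key := hrel.Q_eq (wA := [b, a]) (wB := [b, a]) (wC := [b, a]) ⟨rfl, rfl⟩ ⟨rfl, rfl⟩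
    (by cases a <;> cases b <;> simp [smoothing, IsTangle, Layer.src, Layer.tgt, Elem.src,
      Elem.tgt, Dir.flip]) (by simp) (l := l) (r := r)
    (by simpa [Layer.whisker] using hp) (by simpa [Layer.whisker] using hm)
    (by rw [h₀]; unfold smoothing; split_ifs <;> simp [Layer.whisker])
  rw [key, add_sub_cancel_left]

theorem Q_addsCircle {s : k} (hs : s ≠ 0) (c d : Fin 2 → k) {D D' : Diagram}
    (h : AddsCircle D D') : Q s c d D = (s ^ 2 + (s ^ 2)⁻¹) * Q s c d D' := by
  obtain ⟨l, r, a, top, bot, hD, hD'⟩ := h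
  exact Q_eq_mul_of_phi_eq_smul (phi_circle hs c d a) (w := []) ⟨rfl, rfl, rfl⟩ rfl (by simp)
    (l := l) (r := r)
    (by simpa [Layer.whisker] using hD) (by simpa using hD')

theorem Q_addsCurl {s : k} (hs : s ≠ 0) (c d : Fin 2 → k) {o : Over} {D D' : Diagram}
    (h : AddsCurl o D D') : Q s c d D = curlFactor s o * Q s c d D' := by
  obtain ⟨l, r, a, ⟨top, bot, hD, hD'⟩ | ⟨top, bot, hD, hD'⟩⟩ := h
  · exact Q_eq_mul_of_phi_eq_smul (phi_curlRight hs c d o a)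
      (w := [a]) (wA := [a]) ⟨rfl, rfl, rfl, rfl⟩ rfl
      (by simp [curlRight]) (l := l) (r := r)
      (by simpa [curlRight, Layer.whisker] using hD) (by simpa using hD')
  · exact Q_eq_mul_of_phi_eq_smul (phi_curlLeft hs c d o a)
      (w := [a]) (wA := [a])
      ⟨rfl, by cases a <;> rfl, by cases a <;> rfl, rfl⟩ rfl
      (by simp [curlLeft]) (l := l) (r := r)
      (by simpa [curlLeft, Layer.whisker] using hD) (by simpa using hD')

/-! ### End-points and the vertical segment -/

theorem phi_leg (s : k) (c d : Fin 2 → k) :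
    phi s c d [⟨[], .leg, []⟩] (Finsupp.single [] 1) =
      c 0 • Finsupp.single [0] 1 + c 1 • Finsupp.single [1] 1 := by
  have := layerMap_single s c d [] [] .leg (x := []) (y := []) rfl rfl [] 1
  simpa [phi, pieceMap, Fin.sum_univ_two] using this

theorem phi_head (s : k) (c d : Fin 2 → k) (i : Fin 2) :
    phi s c d [⟨[], .head, []⟩] (Finsupp.single [i] 1) = d i • Finsupp.single [] 1 := by
  have := layerMap_single s c d [] [] .head (x := []) (y := [i]) rfl rfl [] 1
  simpa [phi, pieceMap] using this

theorem Q_trivialDiagram (s : k) (c d : Fin 2 → k) :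
    Q s c d trivialDiagram = c 0 * d 0 + c 1 * d 1 := by
  have : trivialDiagram.layers = [⟨[], .leg, []⟩] ++ [⟨[], .head, []⟩] := rfl
  rw [Q, this, phi_append, phi_leg, map_add, map_smul, map_smul, phi_head, phi_head]
  simp

end Assignment

end TriKnotoid

theorem proposition3p10 {k : Type*} [Field k] (s : k) (hs : s ≠ 0) (c d : Fin 2 → k) :
    -- `Q` is an invariant of triframed planar diagrams
    (∀ D D' : TriKnotoid.Diagram, TriKnotoid.TriframedEquiv D D' →
      TriKnotoid.Q s c d D = TriKnotoid.Q s c d D') ∧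
    -- away from the end-points, `φ` consists of morphisms of `U_q(sl_2)`-modules
    (∀ g : TriKnotoid.Elem, ¬ g.IsEndpoint → TriKnotoid.IsUqLinear s c d g) ∧
    -- the values of `φ` on the end-points
    TriKnotoid.phi s c d [⟨[], .leg, []⟩] (Finsupp.single [] 1) =
      c 0 • Finsupp.single [0] 1 + c 1 • Finsupp.single [1] 1 ∧
    (∀ i, TriKnotoid.phi s c d [⟨[], .head, []⟩] (Finsupp.single [i] 1) =
      d i • Finsupp.single [] 1) ∧
    -- the relation between `R` and its inverse
    IsUnit (TriKnotoid.R s) ∧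
    s • TriKnotoid.R s - s⁻¹ • (TriKnotoid.R s)⁻¹ =
      (s ^ 2 - (s ^ 2)⁻¹) • (1 : Matrix (Fin 4) (Fin 4) k) ∧
    -- the skein relation
    (∀ Dp Dm D₀ : TriKnotoid.Diagram, TriKnotoid.IsSkeinTriple Dp Dm D₀ →
      s * TriKnotoid.Q s c d Dp - s⁻¹ * TriKnotoid.Q s c d Dm =
        (s ^ 2 - (s ^ 2)⁻¹) * TriKnotoid.Q s c d D₀) ∧
    -- circles, curls, and the trivial diagram
    (∀ D D' : TriKnotoid.Diagram, TriKnotoid.AddsCircle D D' →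
      TriKnotoid.Q s c d D = (s ^ 2 + (s ^ 2)⁻¹) * TriKnotoid.Q s c d D') ∧
    (∀ D D' : TriKnotoid.Diagram, TriKnotoid.AddsCurl .slash D D' →
      TriKnotoid.Q s c d D = s ^ 3 * TriKnotoid.Q s c d D') ∧
    (∀ D D' : TriKnotoid.Diagram, TriKnotoid.AddsCurl .back D D' →
      TriKnotoid.Q s c d D = (s ^ 3)⁻¹ * TriKnotoid.Q s c d D') ∧
    TriKnotoid.Q s c d TriKnotoid.trivialDiagram = c 0 * d 0 + c 1 * d 1 := by
  open TriKnotoid in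
  exact ⟨fun _ _ h => Q_eq_of_triframedEquiv hs c d h, isUqLinear hs c d, phi_leg s c d,
    phi_head s c d, isUnit_R hs, R_skein hs, fun _ _ _ h => Q_skein hs c d h,
    fun _ _ h => Q_addsCircle hs c d h, fun _ _ h => Q_addsCurl hs c d h,
    fun _ _ h => Q_addsCurl hs c d h, Q_trivialDiagram s c d⟩
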